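/- Algebras are non-empty algebras of a fixed finitary type. For an algebra $M$, ${\rm Con}(M)$ is its congruence lattice ordered by inclusion, $\Delta_M$ the equality relation and $\nabla_M=M^2$. $M$ is *subdirectly irreducible* if, for every subdirect embedding $h:M\to\prod_{i\in I}M_i$ ($I\neq\emptyset$; $h$ an injective morphism all of whose components $p_i\circ h$ are surjective), some component $p_i\circ h$ is an isomorphism. An element $x$ of a lattice is *meet-irreducible* if $x=a\wedge b$ implies $x=a$ or $x=b$, and *strictly meet-irreducible* if $\{y\mid x<y\}$ has a minimum. An equational class is *congruence-modular* (*congruence-distributive*) if all its members have modular (distributive) congruence lattices. For $\alpha,\beta\in{\rm Con}(M)$, the *commutator* $[\alpha,\beta]_M$ is the least $\delta\in{\rm Con}(M)$ such that, for every term $t(\bar x,\bar y)$ and all tuples $\bar a,\bar b,\bar c,\bar d$ with $a_i\mathrel{\alpha}b_i$ and $c_j\mathrel{\beta}d_j$ for all $i,j$, $t(\bar a,\bar c)\mathrel{\delta}t(\bar a,\bar d)$ implies $t(\bar b,\bar c)\mathrel{\delta}t(\bar b,\bar d)$. A congruence $\phi\ne\nabla_M$ is *prime*, written $\phi\in{\rm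 Spec}(M)$, if $[\alpha,\beta]_M\subseteq\phi$ implies $\alpha\subseteq\phi$ or $\beta\subseteq\phi$ for all $\alpha,\beta\in{\rm Con}(M)$. *The commutator in $M$ equals the intersection* if $[\alpha,\beta]_M=\alpha\cap\beta$ for all $\alpha,\beta\in{\rm Con}(M)$. **Corollary.** Let ${\cal C}$ be an equational class of algebras and $A$ a non-trivial algebra (at least two elements) from ${\cal C}$. 1. $A$ is subdirectly irreducible iff $\Delta_A$ is strictly meet-irreducible in the lattice ${\rm Con}(A)$. 2. If ${\cal C}$ is congruence-modular, the commutator in $A$ equals the intersection and $A$ is subdirectly irreducible, then $\Delta_A\in{\rm Spec}(A)$. 3. If ${\cal C}$ is congruence-distributive and $A$ is subdirectly irreducible, then $\Delta_A\in{\rm Spec}(A)$. 4. If ${\cal C}$ is congruence-modular, the commutator in $A$ equals the intersection and ${\rm Con}(A)$ is finite, then: $A$ is subdirectly irreducible iff $\Delta_A\in{\rm Spec}(A)$ iff $\Delta_A$ is meet-irreducible in ${\rm Con}(A)$. 5. If ${\cal C}$ is congruence-distributive and ${\rm Con}(A)$ is finite, then: $A$ is subdirectly irreducible iff $\Delta_A\in{\rm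 Spec}(A)$ iff $\Delta_A$ is meet-irreducible in ${\rm Con}(A)$. -/

import Mathlib

universe u v w

namespace UAlg

open FirstOrder

/-! Algebras of a given (finitary) type are structures over a language `L` without relation
symbols (`L.IsAlgebraic`). -/

section Congruences

/-- A congruence of the algebra `A`: an equivalence relation on `A` compatible with all the
basic operations. -/
structure Congruence (L : FirstOrder.Language.{u, v}) (A : Type w) [L.Structure A] extends Setoid A where
  map_funMap : ∀ {n : ℕ} (f : L.Functions n) (x y : Fin n → A),
    (∀ i, r (x i) (y i)) → r (FirstOrder.Language.Structure.funMap f x) (FirstOrder.Language.Structure.funMap f y)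

namespace Congruence

variable {L : FirstOrder.Language.{u, v}} {A : Type w} [L.Structure A]

theorem toSetoid_injective :
    Function.Injective (Congruence.toSetoid : Congruence L A → Setoid A) := by
  rintro ⟨s, hs⟩ ⟨t, ht⟩ h
  cases h
  rfl

/-- Congruences are ordered by inclusion. -/
instance : PartialOrder (Congruence L A) where
  le α β := ∀ ⦃x y : A⦄, α.r x y → β.r x y
  le_refl _ _ _ h := h
  le_trans _ _ _ h₁ h₂ _ _ h := h₂ (h₁ h)
  le_antisymm _ _ h₁ h₂ := toSetoid_injective (Setoid.ext fun _ _ => ⟨fun h => h₁ h, fun h => h₂ h⟩)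

/-- The intersection of a set of congruences. -/
instance : InfSet (Congruence L A) where
  sInf S :=
    { r := fun x y => ∀ θ ∈ S, θ.r x y
      iseqv := ⟨fun x θ _ => θ.iseqv.refl x, fun h θ hθ => θ.iseqv.symm (h θ hθ),
        fun h₁ h₂ θ hθ => θ.iseqv.trans (h₁ θ hθ) (h₂ θ hθ)⟩
      map_funMap := fun f x y h θ hθ => θ.map_funMap f x y fun i => h i θ hθ }

/-- The complete lattice `Con(A)`: meets are intersections, the bottom `⊥` is the equality
relation `Δ_A`, the top `⊤` is the full relation, and the join of a family is the congruence
generated by its union. -/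
instance : CompleteLattice (Congruence L A) where
  __ := completeLatticeOfInf (Congruence L A) fun _ =>
    ⟨fun θ hθ _ _ h => h θ hθ, fun _ hθ _ _ h _ hθ' => hθ hθ' h⟩
  inf α β :=
    { r := fun x y => α.r x y ∧ β.r x y
      iseqv := ⟨fun x => ⟨α.iseqv.refl x, β.iseqv.refl x⟩,
        fun h => ⟨α.iseqv.symm h.1, β.iseqv.symm h.2⟩,
        fun h₁ h₂ => ⟨α.iseqv.trans h₁.1 h₂.1, β.iseqv.trans h₁.2 h₂.2⟩⟩
      map_funMap := fun f x y h =>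
        ⟨α.map_funMap f x y fun i => (h i).1, β.map_funMap f x y fun i => (h i).2⟩ }
  inf_le_left _ _ _ _ h := h.1
  inf_le_right _ _ _ _ h := h.2
  le_inf _ _ _ h₁ h₂ _ _ h := ⟨h₁ h, h₂ h⟩
  top :=
    { r := fun _ _ => True
      iseqv := ⟨fun _ => trivial, fun _ => trivial, fun _ _ => trivial⟩
      map_funMap := fun _ _ _ _ => trivial }
  le_top _ _ _ _ := trivial
  bot :=
    { r := fun x y => x = y
      iseqv := ⟨fun _ => rfl, fun h => h.symm, fun h₁ h₂ => h₁.trans h₂⟩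
      map_funMap := fun f _ _ h => congrArg (FirstOrder.Language.Structure.funMap f) (funext h) }
  bot_le θ x _ h := h ▸ θ.iseqv.refl x

end Congruence

end Congruences

section LatticeNotions

/-- `x` is meet-irreducible: `x = a ∧ b` implies `x = a` or `x = b`
(the greatest element is allowed). -/
def MeetIrreducible {P : Type*} [Lattice P] (x : P) : Prop :=
  ∀ a b : P, x = a ⊓ b → x = a ∨ x = b

/-- `x` is strictly meet-irreducible: the set `{y | x < y}` has a minimum. -/
def StrictlyMeetIrreducible {P : Type*} [Lattice P] (x : P) : Prop :=
  ∃ m : P, IsLeast {y : P | x < y} m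

end LatticeNotions

section Subdirect

/-- The direct product of a family of algebras, with componentwise operations. -/
instance piStructure (L : FirstOrder.Language.{u, v}) {ι : Type*} (B : ι → Type*)
    [∀ i, L.Structure (B i)] : L.Structure (∀ i, B i) where
  funMap f x := fun i => FirstOrder.Language.Structure.funMap f fun j => x j i
  RelMap R x := ∀ i, FirstOrder.Language.Structure.RelMap R fun j => x j i

/-- A morphism `h : A → ∏ i, B i` is a subdirect embedding if it is injective and all the
composites with the projections `∏ i, B i → B i` are surjective. -/
def IsSubdirectEmbedding {L : FirstOrder.Language.{u, v}} {A : Type*} [L.Structure A] {ι : Type*}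
    {B : ι → Type*} [∀ i, L.Structure (B i)] (h : A →[L] (∀ i, B i)) : Prop :=
  Function.Injective h ∧ ∀ i, Function.Surjective fun a => h a i

/-- `A` is subdirectly irreducible: for every subdirect embedding of `A` in the product of a
non-empty family of algebras, the composite with some projection is an isomorphism (over an
algebraic language, a bijective morphism). The factors are homomorphic images of `A`, so it is no
restriction to take them in the universe of `A`. -/
def IsSubdirectlyIrreducible (L : FirstOrder.Language.{u, v}) (A : Type w) [L.Structure A] : Prop :=
  ∀ (ι : Type w) [Nonempty ι] (B : ι → Type w) [∀ i, L.Structure (B i)]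
    (h : A →[L] (∀ i, B i)), IsSubdirectEmbedding h → ∃ i, Function.Bijective fun a => h a i

end Subdirect

section EquationalClasses

/-- Membership of the algebra `M` in the equational class axiomatized by the set `E` of
equations `s ≈ t` (terms in countably many variables). -/
def Satisfies {L : FirstOrder.Language.{u, v}} (E : Set (L.Term ℕ × L.Term ℕ)) (M : Type w)
    [L.Structure M] : Prop :=
  ∀ e ∈ E, ∀ x : ℕ → M, e.1.realize x = e.2.realize x

/-- The equational class of `E` is congruence-modular. -/
def CongruenceModular {L : FirstOrder.Language.{u, v}} (E : Set (L.Term ℕ × L.Term ℕ)) : Prop :=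
  ∀ (M : Type w) [Nonempty M] [L.Structure M], Satisfies E M → IsModularLattice (Congruence L M)

/-- The equational class of `E` is congruence-distributive. -/
def CongruenceDistributive {L : FirstOrder.Language.{u, v}} (E : Set (L.Term ℕ × L.Term ℕ)) : Prop :=
  ∀ (M : Type w) [Nonempty M] [L.Structure M], Satisfies E M →
    ∀ α β γ : Congruence L M, α ⊓ (β ⊔ γ) = (α ⊓ β) ⊔ (α ⊓ γ)

end EquationalClasses

section Commutator

variable {L : FirstOrder.Language.{u, v}} {A : Type w} [L.Structure A]

/-- `α` centralizes `β` modulo `δ` (the term condition): for every term `t(x̄, ȳ)` and all tuples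
with `a ≡ b` mod `α` and `c ≡ d` mod `β`, if `t(a, c) ≡ t(a, d)` mod `δ` then
`t(b, c) ≡ t(b, d)` mod `δ`. -/
def Centralizes (α β δ : Congruence L A) : Prop :=
  ∀ (m n : ℕ) (t : L.Term (Fin m ⊕ Fin n)) (a b : Fin m → A) (c d : Fin n → A),
    (∀ i, α.r (a i) (b i)) → (∀ j, β.r (c j) (d j)) →
      δ.r (t.realize (Sum.elim a c)) (t.realize (Sum.elim a d)) →
        δ.r (t.realize (Sum.elim b c)) (t.realize (Sum.elim b d))

/-- The commutator `[α, β]_A`: the least congruence `δ` such that `α` centralizes `β` modulo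
`δ`. -/
def commutator (α β : Congruence L A) : Congruence L A :=
  sInf {δ : Congruence L A | Centralizes α β δ}

theorem isLeast_commutator (α β : Congruence L A) :
    IsLeast {δ : Congruence L A | Centralizes α β δ} (commutator α β) :=
  ⟨fun m n t a b c d hab hcd h δ hδ => hδ m n t a b c d hab hcd (h δ hδ),
    fun _ hδ => sInf_le hδ⟩

variable (L A) in
/-- The commutator in `A` equals the intersection of congruences. -/
def CommutatorEqInf : Prop :=
  ∀ α β : Congruence L A, commutator α β = α ⊓ β

/-- `φ` is a prime congruence, that is, `φ ∈ Spec(A)`: it is proper and `[α, β]_A ⊆ φ` implies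
`α ⊆ φ` or `β ⊆ φ`. -/
def IsPrimeCongruence (φ : Congruence L A) : Prop :=
  φ ≠ ⊤ ∧ ∀ α β : Congruence L A, commutator α β ≤ φ → α ≤ φ ∨ β ≤ φ

end Commutator

end UAlg

namespace UAlg

open FirstOrder Language

/-! ### Meet-irreducibility in complete lattices. -/

section Lattice

variable {P : Type*} [CompleteLattice P]

/-! Subdirect embeddings of `A` correspond to families of congruences with intersection `⊥`, so `A`
is subdirectly irreducible iff the non-zero congruences have a non-zero intersection
(`isSubdirectlyIrreducible_iff`). In a finite lattice this amounts to meet-irreducibility of `⊥`.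

Primeness of `⊥` is meet-irreducibility with the commutator in place of the intersection. Since `[α,
β] ≤ α ⊓ β` always, the two agree once `[α, β] = ⊥` forces `α ⊓ β = ⊥`
(`isPrimeCongruence_bot_iff`). This is immediate if the commutator is the intersection. In the
distributive case `θ = α ⊓ β` is abelian, and one works in `θ` as a subalgebra of `A × A`: the term
condition makes the syntactic congruence of the diagonal collapse `θ`-related diagonal pairs, and
distributivity of its congruence lattice then forces `θ = ⊥` (`eq_bot_of_centralizes_self`). -/

theorem StrictlyMeetIrreducible.meetIrreducible {x : P} (h : StrictlyMeetIrreducible x) :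
    MeetIrreducible x := by
  obtain ⟨m, hm, hleast⟩ := h
  rintro a b hab
  by_contra! hne
  have ha : x < a := lt_of_le_of_ne (hab ▸ inf_le_left) hne.1
  have hb : x < b := lt_of_le_of_ne (hab ▸ inf_le_right) hne.2
  have hmx : m ≤ x := hab ▸ le_inf (hleast ha) (hleast hb)
  exact hm.not_ge hmx

/-- The elements above `x` are finite in number, so their meet stays strictly above `x`; `x ≠ ⊤`
covers the empty meet. -/
theorem MeetIrreducible.strictlyMeetIrreducible [Finite P] {x : P} (h : MeetIrreducible x)
    (hx : x ≠ ⊤) : StrictlyMeetIrreducible x := by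
  classical
  have key : ∀ s : Finset P, (∀ y ∈ s, x < y) → x < s.inf id := by
    intro s
    induction s using Finset.induction_on with
    | empty => intro _; simpa using hx.lt_top
    | insert a s _ ih =>
      intro hs
      have ha : x < a := hs a (Finset.mem_insert_self a s)
      have hi : x < s.inf id := ih fun y hy => hs y (Finset.mem_insert_of_mem hy)
      rw [Finset.inf_insert, id]
      refine lt_of_le_of_ne (le_inf ha.le hi.le) fun heq => ?_
      exact (h _ _ heq).elim ha.ne hi.ne
  have hfin : {y : P | x < y}.Finite := Set.toFinite _
  refine ⟨hfin.toFinset.inf id, key _ fun y hy => by simpa using hy, fun y hy => ?_⟩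
  exact Finset.inf_le (f := id) (by simpa using hy)

theorem strictlyMeetIrreducible_iff_meetIrreducible [Finite P] {x : P} (hx : x ≠ ⊤) :
    StrictlyMeetIrreducible x ↔ MeetIrreducible x :=
  ⟨fun h => h.meetIrreducible, fun h => h.strictlyMeetIrreducible hx⟩

end Lattice

variable {L : FirstOrder.Language.{u, v}} {A : Type w} [L.Structure A]

namespace Congruence

theorem eq_bot_of_forall {α : Congruence L A} (h : ∀ x y, α.r x y → x = y) : α = ⊥ :=
  le_bot_iff.1 fun x y hxy => h x y hxy

theorem bot_ne_top [Nontrivial A] : (⊥ : Congruence L A) ≠ ⊤ := by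
  obtain ⟨x, y, hxy⟩ := exists_pair_ne A
  intro h
  have hxy' : (⊤ : Congruence L A).r x y := trivial
  rw [← h] at hxy'
  exact hxy hxy'

theorem realize_rel (θ : Congruence L A) {κ : Type*} (t : L.Term κ) {x y : κ → A}
    (h : ∀ k, θ.r (x k) (y k)) : θ.r (t.realize x) (t.realize y) := by
  induction t with
  | var k => exact h k
  | func f ts ih => exact θ.map_funMap f _ _ ih

/-- The kernel of a map compatible with the operations. -/
def ker {B : Type*} [L.Structure B] (h : A → B)
    (hf : ∀ {n : ℕ} (f : L.Functions n) (x : Fin n → A),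
      h (Structure.funMap f x) = Structure.funMap f fun i => h (x i)) : Congruence L A where
  r x y := h x = h y
  iseqv := ⟨fun _ => rfl, fun h => h.symm, fun h₁ h₂ => h₁.trans h₂⟩
  map_funMap f x y hxy := by
    rw [hf, hf]
    exact congrArg _ (funext hxy)

/-- The quotient algebra of `A` by the congruence `θ`. -/
@[reducible]
noncomputable def quotientStructure (θ : Congruence L A) : L.Structure (Quotient θ.toSetoid) where
  funMap f x := Quotient.mk _ (Structure.funMap f fun i => (x i).out)
  RelMap _ _ := False

theorem quotient_mk_funMap (θ : Congruence L A) {n : ℕ} (f : L.Functions n) (x : Fin n → A) :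
    (Quotient.mk θ.toSetoid (Structure.funMap f x)) =
      θ.quotientStructure.funMap f fun i => Quotient.mk θ.toSetoid (x i) :=
  Quotient.sound (θ.map_funMap f _ _ fun i => θ.iseqv.symm (Quotient.mk_out (x i)))

end Congruence

/-! ### Subdirect irreducibility and the least non-zero congruence. -/

/-- If no component is injective, every kernel contains the least non-zero congruence `m`; but the
kernels intersect in `⊥`. -/
theorem isSubdirectlyIrreducible_of_strictlyMeetIrreducible
    (h : StrictlyMeetIrreducible (⊥ : Congruence L A)) : IsSubdirectlyIrreducible L A := by
  obtain ⟨m, hm, hleast⟩ := h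
  intro ι _ B _ g hg
  by_contra! hne
  refine hm.ne' (Congruence.eq_bot_of_forall fun x y hxy => hg.1 (funext fun i => ?_))
  let κ : Congruence L A := Congruence.ker (fun a => g a i) fun f x =>
    congrFun (g.map_fun f x) i
  have hκ : κ ≠ ⊥ := fun heq => hne i ⟨fun a b hab => by
    have : κ.r a b := hab
    rwa [heq] at this, hg.2 i⟩
  exact hleast (bot_lt_iff_ne_bot.2 hκ) hxy

/-- If the non-zero congruences met in `⊥`, the map to the product of all their quotients would be a
subdirect embedding with no injective component. -/
theorem strictlyMeetIrreducible_of_isSubdirectlyIrreducible [L.IsAlgebraic] [Nontrivial A]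
    (h : IsSubdirectlyIrreducible L A) : StrictlyMeetIrreducible (⊥ : Congruence L A) := by
  refine ⟨sInf {θ | ⊥ < θ}, ?_, fun θ hθ => sInf_le hθ⟩
  rw [Set.mem_ofPred_eq, bot_lt_iff_ne_bot]
  intro hbot
  let ι := {θ : Congruence L A // ⊥ < θ}
  have : Nonempty ι := ⟨⊤, bot_lt_iff_ne_bot.2 Congruence.bot_ne_top.symm⟩
  let (θ : ι) : L.Structure (Quotient θ.1.toSetoid) := θ.1.quotientStructure
  let g : A →[L] (∀ θ : ι, Quotient θ.1.toSetoid) :=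
    { toFun := fun a θ => Quotient.mk _ a
      map_fun' := fun f x => funext fun θ => θ.1.quotient_mk_funMap f x
      map_rel' := fun R => isEmptyElim R }
  have hg : IsSubdirectEmbedding g := by
    refine ⟨fun x y hxy => ?_, fun θ => Quotient.mk_surjective⟩
    have hr : (sInf {θ : Congruence L A | ⊥ < θ}).r x y := fun θ hθ =>
      Quotient.exact (congrFun hxy ⟨θ, hθ⟩)
    rwa [hbot] at hr
  obtain ⟨θ, hθ⟩ := h ι _ g hg
  exact θ.2.ne' (Congruence.eq_bot_of_forall fun x y hxy => hθ.1 (Quotient.sound hxy))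

theorem isSubdirectlyIrreducible_iff [L.IsAlgebraic] [Nontrivial A] :
    IsSubdirectlyIrreducible L A ↔ StrictlyMeetIrreducible (⊥ : Congruence L A) :=
  ⟨strictlyMeetIrreducible_of_isSubdirectlyIrreducible,
    isSubdirectlyIrreducible_of_strictlyMeetIrreducible⟩

/-! ### The commutator and the term condition. -/

section Commutator

theorem commutator_le_inf (α β : Congruence L A) : commutator α β ≤ α ⊓ β := by
  refine (isLeast_commutator α β).2 fun m n t a b c d hab hcd h => ⟨?_, ?_⟩
  · have h₁ : α.r (t.realize (Sum.elim a c)) (t.realize (Sum.elim b c)) :=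
      α.realize_rel t (Sum.rec hab fun j => α.iseqv.refl _)
    have h₂ : α.r (t.realize (Sum.elim a d)) (t.realize (Sum.elim b d)) :=
      α.realize_rel t (Sum.rec hab fun j => α.iseqv.refl _)
    exact α.iseqv.trans (α.iseqv.symm h₁) (α.iseqv.trans h.1 h₂)
  · exact β.realize_rel t (Sum.rec (fun i => β.iseqv.refl _) hcd)

theorem Centralizes.mono {α α' β β' δ : Congruence L A} (h : Centralizes α β δ) (hα : α' ≤ α)
    (hβ : β' ≤ β) : Centralizes α' β' δ :=
  fun m n t a b c d hab hcd => h m n t a b c d (fun i => hα (hab i)) fun j => hβ (hcd j)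

/-- The term condition holds for terms in arbitrary families of variables. -/
theorem Centralizes.realize {α β δ : Congruence L A} (h : Centralizes α β δ) {I J : Type*}
    (t : L.Term (I ⊕ J)) {a b : I → A} {c d : J → A} (hab : ∀ i, α.r (a i) (b i))
    (hcd : ∀ j, β.r (c j) (d j))
    (ht : δ.r (t.realize (Sum.elim a c)) (t.realize (Sum.elim a d))) :
    δ.r (t.realize (Sum.elim b c)) (t.realize (Sum.elim b d)) := by
  classical
  -- Only finitely many variables occur in `t`; numbering them gives a term of the form required by
  -- `Centralizes`.
  let I' := {i // i ∈ t.varFinset.toLeft}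
  let J' := {j // j ∈ t.varFinset.toRight}
  let e : I' ≃ Fin _ := Fintype.equivFin I'
  let k : J' ≃ Fin _ := Fintype.equivFin J'
  let ρ : t.varFinset → Fin (Fintype.card I') ⊕ Fin (Fintype.card J') := fun v =>
    match v with
    | ⟨Sum.inl i, hi⟩ => Sum.inl (e ⟨i, Finset.mem_toLeft.2 hi⟩)
    | ⟨Sum.inr j, hj⟩ => Sum.inr (k ⟨j, Finset.mem_toRight.2 hj⟩)
  have key : ∀ (x : I → A) (y : J → A),
      (t.restrictVar ρ).realize
        (Sum.elim (fun i => x (e.symm i)) fun j => y (k.symm j)) =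
      t.realize (Sum.elim x y) := by
    intro x y
    refine Term.realize_restrictVar (t := t) (f := ρ) (Sum.elim x y) ?_
    rintro ⟨i | j, hv⟩ <;> simp [ρ]
  have := h _ _ (t.restrictVar ρ) (fun i => a (e.symm i)) (fun i => b (e.symm i))
    (fun j => c (k.symm j)) (fun j => d (k.symm j)) (fun i => hab _) fun j => hcd _
  rw [key, key, key, key] at this
  exact this ht

end Commutator

/-! ### Translations and syntactic congruences. -/

section Translations

/-- The translations of an algebra: composites of basic operations with all but one of the
arguments fixed. -/
inductive IsTranslation (L : FirstOrder.Language.{u, v}) {B : Type w} [L.Structure B] :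
    (B → B) → Prop
  | refl : IsTranslation L id
  | comp {g : B → B} {n : ℕ} (f : L.Functions n) (z : Fin n → B) (i : Fin n) :
      IsTranslation L g →
        IsTranslation L fun x => g (Structure.funMap f (Function.update z i x))

/-- The largest congruence saturating the set `D`. -/
def syntacticCongruence (L : FirstOrder.Language.{u, v}) {B : Type w} [L.Structure B]
    (D : Set B) : Congruence L B where
  r p q := ∀ g : B → B, IsTranslation L g → (g p ∈ D ↔ g q ∈ D)
  iseqv := ⟨fun _ _ _ => Iff.rfl, fun h g hg => (h g hg).symm,
    fun h₁ h₂ g hg => (h₁ g hg).trans (h₂ g hg)⟩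
  map_funMap {n} f x y hxy g hg := by
    classical
    -- Replace `x` by `y` one argument at a time; each replacement is a translation followed by `g`.
    have key : ∀ s : Finset (Fin n), g (Structure.funMap f x) ∈ D ↔
        g (Structure.funMap f (s.piecewise y x)) ∈ D := by
      intro s
      induction s using Finset.induction_on with
      | empty => simp
      | insert i s hi ih =>
        rw [ih, Finset.piecewise_insert]
        have := hxy i _ (IsTranslation.comp f (s.piecewise y x) i hg)
        have hxi : Function.update (s.piecewise y x) i (x i) = s.piecewise y x := by
          rw [Function.update_eq_self_iff, Finset.piecewise_eq_of_notMem _ _ _ hi]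
        rwa [hxi] at this
    simpa using key Finset.univ

/-- The fixed arguments become variables indexed by `B` itself, so that the term condition applies
to translations. -/
theorem IsTranslation.exists_term {B : Type w} [L.Structure B] {g : B → B}
    (hg : IsTranslation L g) :
    ∃ t : L.Term (Unit ⊕ B), ∀ x, g x = t.realize (Sum.elim (fun _ => x) id) := by
  classical
  induction hg with
  | refl => exact ⟨Term.var (Sum.inl ()), fun x => rfl⟩
  | comp f z i _ ih =>
    obtain ⟨t, ht⟩ := ih
    refine ⟨t.subst (Sum.elim (fun _ => Term.func f
      (Function.update (fun j => Term.var (Sum.inr (z j))) i (Term.var (Sum.inl ()))))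
      fun b => Term.var (Sum.inr b)), fun x => ?_⟩
    refine (ht _).trans ?_
    rw [Term.realize_subst]
    congr 1
    funext s
    rcases s with _ | b
    · simp only [Sum.elim_inl, Term.realize_func]
      congr 1
      funext j
      rcases eq_or_ne j i with rfl | hj
      · simp
      · simp [hj]
    · simp

end Translations

/-! ### Abelian congruences as subalgebras of the square. -/

section Square

/-- A congruence `θ` of `A` regarded as a subalgebra of `A × A`. -/
def Congruence.Carrier (θ : Congruence L A) : Type w := {p : A × A // θ.r p.1 p.2}

namespace Congruence

variable (θ : Congruence L A)

instance : L.Structure θ.Carrier where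
  funMap f x := ⟨(Structure.funMap f fun i => (x i).1.1, Structure.funMap f fun i => (x i).1.2),
    θ.map_funMap f _ _ fun i => (x i).2⟩
  RelMap R x := Structure.RelMap R (fun i => (x i).1.1) ∧ Structure.RelMap R fun i => (x i).1.2

variable {θ}

variable (θ) in
/-- The diagonal pair `(a, a)` as an element of `θ`. -/
def Carrier.diag (a : A) : θ.Carrier := ⟨(a, a), θ.iseqv.refl a⟩

theorem Carrier.realize_fst {κ : Type*} (t : L.Term κ) (x : κ → θ.Carrier) :
    (t.realize x).1.1 = t.realize fun k => (x k).1.1 := by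
  induction t with
  | var k => rfl
  | func f ts ih => exact congrArg (Structure.funMap f) (funext ih)

theorem Carrier.realize_snd {κ : Type*} (t : L.Term κ) (x : κ → θ.Carrier) :
    (t.realize x).1.2 = t.realize fun k => (x k).1.2 := by
  induction t with
  | var k => rfl
  | func f ts ih => exact congrArg (Structure.funMap f) (funext ih)

theorem Carrier.satisfies {E : Set (L.Term ℕ × L.Term ℕ)} (hA : Satisfies E A) :
    Satisfies E θ.Carrier := by
  refine fun e he x => Subtype.ext (Prod.ext ?_ ?_)
  · rw [realize_fst, realize_fst, hA e he]
  · rw [realize_snd, realize_snd, hA e he]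

/-- If `θ` is abelian, the syntactic congruence of the diagonal of `θ` identifies any two diagonal
pairs whose entries are `θ`-related. -/
theorem syntacticCongruence_diag (h : Centralizes θ θ ⊥) {a b : A} (hab : θ.r a b) :
    (syntacticCongruence L {p : θ.Carrier | p.1.1 = p.1.2}).r
      (Carrier.diag θ a) (Carrier.diag θ b) := by
  -- The two coordinates of a parameter `z` are `θ`-related, so this is the term condition modulo
  -- equality.
  have key : ∀ {a b : A}, θ.r a b → ∀ t : L.Term (Unit ⊕ θ.Carrier),
      t.realize (Sum.elim (fun _ => a) fun z : θ.Carrier => z.1.1) =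
        t.realize (Sum.elim (fun _ => a) fun z : θ.Carrier => z.1.2) →
      t.realize (Sum.elim (fun _ => b) fun z : θ.Carrier => z.1.1) =
        t.realize (Sum.elim (fun _ => b) fun z : θ.Carrier => z.1.2) :=
    fun hab t => h.realize t (fun _ => hab) fun z => z.2
  intro g hg
  obtain ⟨t, ht⟩ := hg.exists_term
  have hfst : ∀ a : A, (g (Carrier.diag θ a)).1.1 =
      t.realize (Sum.elim (fun _ => a) fun z : θ.Carrier => z.1.1) := fun a => by
    rw [ht, Carrier.realize_fst]
    congr 1
    funext s
    rcases s with _ | _ <;> rfl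
  have hsnd : ∀ a : A, (g (Carrier.diag θ a)).1.2 =
      t.realize (Sum.elim (fun _ => a) fun z : θ.Carrier => z.1.2) := fun a => by
    rw [ht, Carrier.realize_snd]
    congr 1
    funext s
    rcases s with _ | _ <;> rfl
  rw [Set.mem_ofPred_eq, Set.mem_ofPred_eq, hfst, hsnd, hfst, hsnd]
  exact ⟨key hab t, key (θ.iseqv.symm hab) t⟩

/-- A congruence-distributive equational class has no non-trivial abelian congruences. -/
theorem eq_bot_of_centralizes_self [Nonempty A] {E : Set (L.Term ℕ × L.Term ℕ)}
    (hE : CongruenceDistributive.{u, v, w} E) (hA : Satisfies E A) (h : Centralizes θ θ ⊥) :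
    θ = ⊥ := by
  refine eq_bot_of_forall fun x y hxy => ?_
  have : Nonempty θ.Carrier := ⟨⟨(x, y), hxy⟩⟩
  let η₁ : Congruence L θ.Carrier := ker (fun p => p.1.1) fun _ _ => rfl
  let η₂ : Congruence L θ.Carrier := ker (fun p => p.1.2) fun _ _ => rfl
  let Ψ : Congruence L θ.Carrier := syntacticCongruence L {p : θ.Carrier | p.1.1 = p.1.2}
  let p : θ.Carrier := Carrier.diag θ x
  let q : θ.Carrier := ⟨(x, y), hxy⟩
  let s : θ.Carrier := Carrier.diag θ y
  have hbot : η₁ ⊓ η₂ = ⊥ :=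
    eq_bot_of_forall fun p q hpq => Subtype.ext (Prod.ext hpq.1 hpq.2)
  -- The path is `(x, x) Ψ (y, y) η₂ (x, y)`, while its endpoints are `η₁`-related.
  have hps : (η₂ ⊔ Ψ).r p s :=
    (le_sup_right : Ψ ≤ η₂ ⊔ Ψ) (syntacticCongruence_diag h hxy)
  have hsq : (η₂ ⊔ Ψ).r s q :=
    (le_sup_left : η₂ ≤ η₂ ⊔ Ψ) (show s.1.2 = q.1.2 from rfl)
  have hpq : (η₁ ⊓ (η₂ ⊔ Ψ)).r p q := ⟨rfl, (η₂ ⊔ Ψ).iseqv.trans hps hsq⟩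
  -- Distributivity leaves `η₁ ⊓ Ψ`. As `Ψ` saturates the diagonal, `(x, y)` is diagonal along with
  -- `(x, x)`.
  rw [hE θ.Carrier (Carrier.satisfies hA), hbot, bot_sup_eq] at hpq
  exact (hpq.2 id IsTranslation.refl).1 rfl

end Congruence

/-- Centralization is monotone, so `α ⊓ β` centralizes itself modulo `⊥`. -/
theorem inf_eq_bot_of_commutator_eq_bot [Nonempty A] {E : Set (L.Term ℕ × L.Term ℕ)}
    (hE : CongruenceDistributive.{u, v, w} E) (hA : Satisfies E A) {α β : Congruence L A}
    (h : commutator α β = ⊥) : α ⊓ β = ⊥ := by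
  have hc : Centralizes α β ⊥ := h ▸ (isLeast_commutator α β).1
  exact Congruence.eq_bot_of_centralizes_self hE hA (hc.mono inf_le_left inf_le_right)

end Square

theorem isPrimeCongruence_bot_iff [Nontrivial A]
    (h : ∀ α β : Congruence L A, commutator α β = ⊥ → α ⊓ β = ⊥) :
    IsPrimeCongruence (⊥ : Congruence L A) ↔ MeetIrreducible (⊥ : Congruence L A) := by
  constructor
  · rintro ⟨-, hp⟩ α β hαβ
    exact (hp α β ((commutator_le_inf α β).trans hαβ.ge)).imp
      (fun h => (le_bot_iff.1 h).symm) fun h => (le_bot_iff.1 h).symm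
  · refine fun hm => ⟨Congruence.bot_ne_top, fun α β hαβ => ?_⟩
    exact (hm α β (h α β (le_bot_iff.1 hαβ)).symm).imp (fun h => h.ge) fun h => h.ge

end UAlg

theorem corollary9p2 (L : FirstOrder.Language.{u, v}) [L.IsAlgebraic]
    (E : Set (L.Term ℕ × L.Term ℕ)) (A : Type w) [L.Structure A]
    (hA : UAlg.Satisfies E A) [Nontrivial A] :
    (UAlg.IsSubdirectlyIrreducible L A ↔
        UAlg.StrictlyMeetIrreducible (⊥ : UAlg.Congruence L A)) ∧
    (UAlg.CongruenceModular.{u, v, w} E → UAlg.CommutatorEqInf L A →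
      UAlg.IsSubdirectlyIrreducible L A →
        UAlg.IsPrimeCongruence (⊥ : UAlg.Congruence L A)) ∧
    (UAlg.CongruenceDistributive.{u, v, w} E →
      UAlg.IsSubdirectlyIrreducible L A →
        UAlg.IsPrimeCongruence (⊥ : UAlg.Congruence L A)) ∧
    (UAlg.CongruenceModular.{u, v, w} E → UAlg.CommutatorEqInf L A →
      Finite (UAlg.Congruence L A) →
        (UAlg.IsSubdirectlyIrreducible L A ↔
          UAlg.IsPrimeCongruence (⊥ : UAlg.Congruence L A)) ∧
        (UAlg.IsPrimeCongruence (⊥ : UAlg.Congruence L A) ↔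
          UAlg.MeetIrreducible (⊥ : UAlg.Congruence L A))) ∧
    (UAlg.CongruenceDistributive.{u, v, w} E →
      Finite (UAlg.Congruence L A) →
        (UAlg.IsSubdirectlyIrreducible L A ↔
          UAlg.IsPrimeCongruence (⊥ : UAlg.Congruence L A)) ∧
        (UAlg.IsPrimeCongruence (⊥ : UAlg.Congruence L A) ↔
          UAlg.MeetIrreducible (⊥ : UAlg.Congruence L A))) := by
  have hsi := UAlg.isSubdirectlyIrreducible_iff (L := L) (A := A)
  have hinf (hC : UAlg.CommutatorEqInf L A) :=
    UAlg.isPrimeCongruence_bot_iff fun α β h => (hC α β).symm.trans h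
  have hdist (hD : UAlg.CongruenceDistributive.{u, v, w} E) :=
    UAlg.isPrimeCongruence_bot_iff fun _ _ h =>
      UAlg.inf_eq_bot_of_commutator_eq_bot hD hA h
  have hfin (_ : Finite (UAlg.Congruence L A)) :=
    hsi.trans (UAlg.strictlyMeetIrreducible_iff_meetIrreducible UAlg.Congruence.bot_ne_top)
  exact ⟨hsi, fun _ hC h => (hinf hC).2 (hsi.1 h).meetIrreducible,
    fun hD h => (hdist hD).2 (hsi.1 h).meetIrreducible,
    fun _ hC hF => ⟨(hfin hF).trans (hinf hC).symm, hinf hC⟩,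
    fun hD hF => ⟨(hfin hF).trans (hdist hD).symm, hdist hD⟩⟩
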